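/- Let $\mathbb{N}_0=\{0,1,2,\ldots\}$ and let $\ell_\infty(\mathbb{N}_0)$ be the space of bounded complex sequences with the supremum norm $\|\cdot\|_\infty$. Let $\rho(m,n)=|\sqrt{m}-\sqrt{n}|$ for $m,n\in\mathbb{N}_0$. For a sequence $\sigma\colon\mathbb{N}_0\to\mathbb{C}$ and $\delta>0$ put \[ \omega_{\rho,\sigma}(\delta)=\sup\{|\sigma(j)-\sigma(k)|\colon j,k\in\mathbb{N}_0,\ \rho(j,k)\le\delta\}\in[0,+\infty], \] and let \[ \operatorname{RO}(\mathbb{N}_0)=\Bigl\{\sigma\in\ell_\infty(\mathbb{N}_0)\colon \lim_{\delta\to0^+}\omega_{\rho,\sigma}(\delta)=0\Bigr\}. \] Let $\tau_L$ be the left shift operator on $\ell_\infty(\mathbb{N}_0)$, $(\tau_L\sigma)(j)=\sigma(j+1)$. For a (class of) complex-valued, essentially bounded, Lebesgue measurable function $g\in L_\infty([0,+\infty))$, let $\gamma_g\in\ell_\infty(\mathbb{N}_0)$ be the sequence \[ \gamma_g(n)=\frac{1}{n!}\int_0^{+\infty} g(\sqrt{r}\,)\,e^{-r}r^n\,dr\qquad(n\in\mathbb{N}_0).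 \] Proposition. Let $\sigma\in\operatorname{RO}(\mathbb{N}_0)$. Then, for every $\varepsilon>0$, there exist an integer $N\ge1$ and $g\in L_\infty([0,+\infty))$ such that \[ \bigl\|\tau_L^N\sigma-\gamma_g\bigr\|_\infty<\varepsilon. \] -/

import Mathlib

open MeasureTheory Set Filter Topology
open scoped ENNReal

namespace RadialFock

noncomputable section

/-- The space `ℓ_∞(ℕ₀)` of bounded complex sequences with the supremum norm. -/
abbrev EllInfty : Type := lp (fun _ : ℕ => ℂ) ∞

/-- The space `L_∞([0,+∞))` of (classes of) essentially bounded complex functions on the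
half-line, with respect to Lebesgue measure. -/
abbrev LInftyHalfLine : Type := Lp ℂ ∞ (volume.restrict (Ici (0 : ℝ)))

/-- The square-root metric `ρ(m,n) = |√m - √n|` on `ℕ₀`. -/
def sqrtDist (m n : ℕ) : ℝ := |Real.sqrt m - Real.sqrt n|

/-- The modulus of continuity of a complex sequence with respect to the square-root metric,
with values in `[0,+∞]`. -/
def modulus (σ : ℕ → ℂ) (δ : ℝ) : ℝ≥0∞ :=
  ⨆ (j : ℕ) (k : ℕ) (_ : sqrtDist j k ≤ δ), ENNReal.ofReal ‖σ j - σ k‖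

/-- `RO(ℕ₀)`: the bounded sequences that are uniformly continuous with respect to the
square-root metric, i.e. whose modulus of continuity tends to `0` as `δ → 0⁺`. -/
def RO : Set EllInfty :=
  {σ | Tendsto (modulus (fun n => σ n)) (𝓝[>] (0 : ℝ)) (𝓝 0)}

theorem memℓp_shift (σ : EllInfty) : Memℓp (fun j : ℕ => (σ (j + 1) : ℂ)) ∞ := by
  refine memℓp_infty ⟨‖σ‖, ?_⟩
  rintro _ ⟨j, rfl⟩
  exact lp.norm_apply_le_norm ENNReal.top_ne_zero σ (j + 1)

/-- The left shift operator `(τ_L σ)(j) = σ(j+1)` on `ℓ_∞(ℕ₀)`. -/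
def leftShift : EllInfty →L[ℂ] EllInfty :=
  LinearMap.mkContinuous
    { toFun := fun σ => ⟨fun j => σ (j + 1), memℓp_shift σ⟩
      map_add' := fun _ _ => rfl
      map_smul' := fun _ _ => rfl }
    1
    (fun σ => by
      rw [one_mul]
      exact lp.norm_le_of_forall_le (norm_nonneg σ)
        (fun j => lp.norm_apply_le_norm ENNReal.top_ne_zero σ (j + 1)))

theorem leftShift_apply (σ : EllInfty) (j : ℕ) : leftShift σ j = σ (j + 1) := rfl

/-- The number `γ_g(n) = (1/n!) ∫₀^∞ g(√r) e^{-r} r^n dr`. -/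
def gammaCoeff (g : LInftyHalfLine) (n : ℕ) : ℂ :=
  (1 / (n.factorial : ℂ)) *
    ∫ r in Ioi (0 : ℝ), g (Real.sqrt r) * ((Real.exp (-r) * r ^ n : ℝ) : ℂ)

theorem ae_norm_sqrt_le (g : LInftyHalfLine) :
    ∀ᵐ r ∂(volume.restrict (Ioi (0 : ℝ))), ‖g (Real.sqrt r)‖ ≤ ‖g‖ := by
  have h1 : ∀ᵐ x ∂(volume : Measure ℝ), x ∈ Ici (0 : ℝ) → ‖g x‖ ≤ ‖g‖ := by
    rw [← ae_restrict_iff' measurableSet_Ici]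
    have h := ae_le_eLpNormEssSup (f := g) (μ := volume.restrict (Ici (0 : ℝ)))
    filter_upwards [h] with x hx
    rw [Lp.norm_def, eLpNorm_exponent_top]
    have hfin : eLpNormEssSup g (volume.restrict (Ici (0 : ℝ))) ≠ ∞ := by
      rw [← eLpNorm_exponent_top]; exact Lp.eLpNorm_ne_top g
    simpa using ENNReal.toReal_mono hfin hx
  rw [ae_restrict_iff' measurableSet_Ioi]
  rw [ae_iff] at h1 ⊢
  have h2 := addHaar_image_eq_zero_of_differentiableOn_of_addHaar_eq_zero (volume : Measure ℝ)
    (f := fun x : ℝ => x ^ 2) (by fun_prop) h1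
  refine measure_mono_null ?_ h2
  intro r hr
  simp only [mem_ofPred_eq, Classical.not_imp] at hr
  refine ⟨Real.sqrt r, ?_, Real.sq_sqrt (le_of_lt hr.1)⟩
  simp only [mem_ofPred_eq, Classical.not_imp]
  exact ⟨Real.sqrt_nonneg r, hr.2⟩

theorem norm_gammaCoeff_le (g : LInftyHalfLine) (n : ℕ) : ‖gammaCoeff g n‖ ≤ ‖g‖ := by
  have hfac : (0 : ℝ) < (n.factorial : ℝ) := by exact_mod_cast n.factorial_pos
  have hint : IntegrableOn (fun r : ℝ => Real.exp (-r) * r ^ n) (Ioi 0) := by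
    have h := Real.GammaIntegral_convergent (s := (n : ℝ) + 1) (by positivity)
    simpa using h
  have hval : ∫ r in Ioi (0 : ℝ), Real.exp (-r) * r ^ n = (n.factorial : ℝ) := by
    have h := Real.Gamma_eq_integral (s := (n : ℝ) + 1) (by positivity)
    rw [Real.Gamma_nat_eq_factorial] at h
    simpa using h.symm
  have hle : ‖∫ r in Ioi (0 : ℝ), g (Real.sqrt r) * ((Real.exp (-r) * r ^ n : ℝ) : ℂ)‖
      ≤ ∫ r in Ioi (0 : ℝ), ‖g‖ * (Real.exp (-r) * r ^ n) := by
    refine norm_integral_le_of_norm_le (hint.const_mul _) ?_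
    filter_upwards [ae_norm_sqrt_le g, ae_restrict_mem measurableSet_Ioi] with r hr hr0
    have h0 : (0 : ℝ) ≤ Real.exp (-r) * r ^ n :=
      mul_nonneg (Real.exp_pos _).le (pow_nonneg (le_of_lt hr0) n)
    rw [norm_mul, Complex.norm_real, Real.norm_of_nonneg h0]
    exact mul_le_mul_of_nonneg_right hr h0
  rw [integral_const_mul, hval] at hle
  rw [gammaCoeff, norm_mul, norm_div, norm_one, Complex.norm_natCast, one_div,
    inv_mul_le_iff₀ hfac, mul_comm]
  exact hle

/-- The eigenvalue sequence `γ_g ∈ ℓ_∞(ℕ₀)` of the radial Toeplitz operator with symbol `g(|z|)`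
on the Fock space. -/
def gammaSeq (g : LInftyHalfLine) : EllInfty :=
  ⟨gammaCoeff g, memℓp_infty ⟨‖g‖, by rintro _ ⟨n, rfl⟩; exact norm_gammaCoeff_le g n⟩⟩

end

end RadialFock

namespace RadialFock

noncomputable section

/-! The number `γ_g(n)` is the mean of `g(√R)` for `R` Gamma distributed of shape `n + 1`, and `√R -
√n` tends to a fixed centred Gaussian law. The densities converge in `L¹`
(`tendsto_integral_norm_sqrtGammaDensity_sub`), so for bounded `g` and large `n`, `γ_g(n)` is close
to the Gaussian average of `g` around `√n`.

It remains to write a sequence in `RO` approximately as Gaussian averages at the points `√n`.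
Interpolate it by a bounded step function `f` and smooth `f` at a small scale `δ` by a kernel with
compactly supported Fourier transform. Such a kernel is a Gaussian convolved with a Schwartz
function (`exists_gaussDensity_deconvolution`), so the smoothing of `f` is a Gaussian average of a
bounded `G` (`exists_integral_gaussDensity_eq`).

This controls only large `n`, which is why a shift is needed. Shifting stays among the sequences
`γ_g`: a Gamma variable plus an independent exponential one is Gamma with shape raised by one
(`gammaMean_shiftSymbol`). -/

/-! ### Gamma means and the left shift -/

/-- The mean of `a` with respect to the Gamma distribution of shape `n + 1`. -/
def gammaMean (a : ℝ → ℂ) (n : ℕ) : ℂ :=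
  (1 / (n.factorial : ℂ)) * ∫ r in Ioi (0 : ℝ), a r * ((Real.exp (-r) * r ^ n : ℝ) : ℂ)

theorem integrableOn_exp_neg_mul_pow (n : ℕ) :
    IntegrableOn (fun r : ℝ => Real.exp (-r) * r ^ n) (Ioi 0) := by
  have h := Real.GammaIntegral_convergent (s := (n : ℝ) + 1) (by positivity)
  simpa using h

/-- Take the class of `x ↦ a (x ^ 2)`. Squaring maps null sets to null sets, so the choice of
representative does not affect the integral in `r = x²`. -/
theorem exists_gammaCoeff_eq {a : ℝ → ℂ} (ha : Measurable a) {C : ℝ} (hC : ∀ r, ‖a r‖ ≤ C) :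
    ∃ g : LInftyHalfLine, ∀ n, gammaCoeff g n = gammaMean a n := by
  have hmem : MemLp (fun x : ℝ => a (x ^ 2)) ∞ (volume.restrict (Ici (0 : ℝ))) :=
    memLp_top_of_bound (ha.comp (measurable_id.pow_const 2)).aestronglyMeasurable C
      (Eventually.of_forall fun x => hC _)
  refine ⟨hmem.toLp _, fun n => ?_⟩
  have h1 : ∀ᵐ x ∂(volume : Measure ℝ), x ∈ Ici (0 : ℝ) → hmem.toLp _ x = a (x ^ 2) := by
    rw [← ae_restrict_iff' measurableSet_Ici]
    exact hmem.coeFn_toLp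
  have h2 : ∀ᵐ r ∂(volume : Measure ℝ), r ∈ Ioi (0 : ℝ) → hmem.toLp _ (Real.sqrt r) = a r := by
    rw [ae_iff] at h1 ⊢
    refine measure_mono_null ?_
      (addHaar_image_eq_zero_of_differentiableOn_of_addHaar_eq_zero (volume : Measure ℝ)
        (f := fun x : ℝ => x ^ 2) (by fun_prop) h1)
    intro r hr
    simp only [mem_ofPred_eq, Classical.not_imp] at hr
    refine ⟨Real.sqrt r, ?_, Real.sq_sqrt (le_of_lt hr.1)⟩
    simp only [mem_ofPred_eq, Classical.not_imp, Real.sq_sqrt (le_of_lt hr.1)]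
    exact ⟨Real.sqrt_nonneg r, hr.2⟩
  rw [gammaCoeff, gammaMean]
  congr 1
  refine setIntegral_congr_ae measurableSet_Ioi ?_
  filter_upwards [h2] with r hr h0
  rw [hr h0]

/-- The symbol whose sequence of Gamma means is the left shift of that of `a`. -/
def shiftSymbol (a : ℝ → ℂ) (r : ℝ) : ℂ :=
  ∫ s in Ioi (0 : ℝ), a (r + s) * ((Real.exp (-s) : ℝ) : ℂ)

theorem measurable_shiftSymbol {a : ℝ → ℂ} (ha : Measurable a) : Measurable (shiftSymbol a) := by
  have h : StronglyMeasurable (Function.uncurry fun r s : ℝ =>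
      a (r + s) * ((Real.exp (-s) : ℝ) : ℂ)) := by
    apply Measurable.stronglyMeasurable
    unfold Function.uncurry
    fun_prop
  exact (h.integral_prod_right (ν := volume.restrict (Ioi (0 : ℝ)))).measurable

theorem norm_shiftSymbol_le {a : ℝ → ℂ} {C : ℝ} (hC : ∀ r, ‖a r‖ ≤ C) (r : ℝ) :
    ‖shiftSymbol a r‖ ≤ C := by
  have h : ‖shiftSymbol a r‖ ≤ ∫ s in Ioi (0 : ℝ), C * Real.exp (-s) := by
    refine norm_integral_le_of_norm_le ((integrableOn_exp_neg_Ioi 0).const_mul C) ?_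
    refine Eventually.of_forall fun s => ?_
    rw [norm_mul, Complex.norm_real, Real.norm_of_nonneg (Real.exp_pos _).le]
    exact mul_le_mul_of_nonneg_right (hC _) (Real.exp_pos _).le
  rwa [integral_const_mul, integral_exp_neg_Ioi_zero, mul_one] at h

/-- Fubini on `0 < r < t` with `t = r + s`: the weights `e^{-r} r^n` and `e^{-s}` multiply to
`e^{-t} r^n`, and integrating out `r` gives `e^{-t} t^(n+1) / (n+1)`. -/
theorem gammaMean_shiftSymbol {a : ℝ → ℂ} (ha : Measurable a) {C : ℝ} (hC : ∀ r, ‖a r‖ ≤ C)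
    (n : ℕ) : gammaMean (shiftSymbol a) n = gammaMean a (n + 1) := by
  have hshift : ∀ r, shiftSymbol a r = ∫ t, (Ioi r).indicator
      (fun t => a t * ((Real.exp (r - t) : ℝ) : ℂ)) t := by
    intro r
    rw [shiftSymbol, ← integral_indicator measurableSet_Ioi,
      ← integral_sub_right_eq_self _ r]
    congr 1
    ext t
    by_cases h : r < t
    · rw [indicator_of_mem (by simpa using h), indicator_of_mem (by simpa using h)]
      congr 3 <;> ring_nf
    · rw [indicator_of_notMem (by simpa using h), indicator_of_notMem (by simpa using h)]
  let F : ℝ → ℝ → ℂ := fun r t =>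
    {p : ℝ × ℝ | 0 < p.1 ∧ p.1 < p.2}.indicator
      (fun p => a p.2 * ((Real.exp (-p.2) * p.1 ^ n : ℝ) : ℂ)) (r, t)
  have hms : MeasurableSet {p : ℝ × ℝ | 0 < p.1 ∧ p.1 < p.2} :=
    (measurableSet_lt measurable_const measurable_fst).inter
      (measurableSet_lt measurable_fst measurable_snd)
  have hmeas : Measurable (Function.uncurry F) := by
    apply Measurable.indicator _ hms
    fun_prop
  have hleft : ∀ r, (∫ t, F r t) = (Ioi (0 : ℝ)).indicator
      (fun r => shiftSymbol a r * ((Real.exp (-r) * r ^ n : ℝ) : ℂ)) r := by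
    intro r
    by_cases h0 : 0 < r
    · rw [indicator_of_mem (by simpa using h0), hshift, ← integral_mul_const]
      congr 1
      ext t
      by_cases h : r < t
      · simp only [F]
        rw [indicator_of_mem (by exact ⟨h0, h⟩), indicator_of_mem (by simpa using h), mul_assoc,
          ← Complex.ofReal_mul, ← mul_assoc (Real.exp (r - t)), ← Real.exp_add]
        ring_nf
      · simp only [F]
        rw [indicator_of_notMem (by simp [h]), indicator_of_notMem (by simpa using h), zero_mul]
    · rw [indicator_of_notMem (by simpa using h0)]
      simp [F, indicator, h0]
  have hinner : ∀ t : ℝ, 0 < t → ∫ r in (0 : ℝ)..t, r ^ n = t ^ (n + 1) / (n + 1) := by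
    intro t ht
    simp [integral_pow]
  have hFt : ∀ t : ℝ, 0 < t → (fun r => F r t) = (Ioo 0 t).indicator
      (fun r => a t * ((Real.exp (-t) * r ^ n : ℝ) : ℂ)) := by
    intro t ht
    ext r
    simp only [F, indicator, mem_ofPred_eq, mem_Ioo]
  have hFt0 : ∀ t : ℝ, ¬ 0 < t → (fun r => F r t) = 0 := by
    intro t ht
    ext r
    simp only [F]
    rw [indicator_of_notMem (fun h => ht (h.1.trans h.2))]
    rfl
  have hright : ∀ t, (∫ r, F r t) = (Ioi (0 : ℝ)).indicator
      (fun t => a t * ((Real.exp (-t) * t ^ (n + 1) : ℝ) : ℂ) * (1 / ((n : ℂ) + 1))) t := by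
    intro t
    by_cases h0 : 0 < t
    · rw [indicator_of_mem (by simpa using h0), hFt t h0, integral_indicator measurableSet_Ioo,
        integral_const_mul, integral_complex_ofReal, integral_const_mul,
        ← integral_Ioc_eq_integral_Ioo, ← intervalIntegral.integral_of_le h0.le, hinner t h0]
      push_cast
      ring
    · rw [indicator_of_notMem (by simpa using h0), hFt0 t h0]
      simp
  have hint : Integrable (Function.uncurry F) (volume.prod volume) := by
    rw [integrable_prod_iff' hmeas.aestronglyMeasurable]
    constructor
    · refine Eventually.of_forall fun t => ?_
      change Integrable (fun r => F r t)
      by_cases h0 : 0 < t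
      · rw [hFt t h0, integrable_indicator_iff measurableSet_Ioo]
        have : Continuous fun r : ℝ => a t * ((Real.exp (-t) * r ^ n : ℝ) : ℂ) := by fun_prop
        exact (this.integrableOn_Icc (a := 0) (b := t)).mono_set Ioo_subset_Icc_self
      · rw [hFt0 t h0]
        exact integrable_zero _ _ _
    · have hC0 : 0 ≤ C := (norm_nonneg _).trans (hC 0)
      have hdom : Integrable ((Ioi (0 : ℝ)).indicator
          fun t => C * (Real.exp (-t) * t ^ (n + 1))) := by
        rw [integrable_indicator_iff measurableSet_Ioi]
        exact (integrableOn_exp_neg_mul_pow (n + 1)).const_mul C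
      refine hdom.mono' hmeas.norm.stronglyMeasurable.integral_prod_left'.aestronglyMeasurable ?_
      refine Eventually.of_forall fun t => ?_
      rw [Real.norm_of_nonneg (integral_nonneg fun _ => norm_nonneg _)]
      change (∫ r, ‖F r t‖) ≤ _
      by_cases h0 : 0 < t
      · rw [indicator_of_mem (by simpa using h0)]
        have hn : (fun r => ‖F r t‖) = (Ioo 0 t).indicator
            (fun r => ‖a t‖ * Real.exp (-t) * r ^ n) := by
          ext r
          rw [congrFun (hFt t h0) r, norm_indicator_eq_indicator_norm]
          by_cases hr : r ∈ Ioo 0 t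
          · rw [indicator_of_mem hr, indicator_of_mem hr, norm_mul, Complex.norm_real,
              Real.norm_of_nonneg (mul_nonneg (Real.exp_pos _).le (pow_nonneg hr.1.le n)),
              mul_assoc]
          · rw [indicator_of_notMem hr, indicator_of_notMem hr]
        rw [hn, integral_indicator measurableSet_Ioo, integral_const_mul,
          ← integral_Ioc_eq_integral_Ioo, ← intervalIntegral.integral_of_le h0.le, hinner t h0,
          mul_assoc]
        gcongr
        · exact hC t
        · exact div_le_self (by positivity) (by linarith [(Nat.cast_nonneg n : (0 : ℝ) ≤ n)])
      · rw [indicator_of_notMem (by simpa using h0)]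
        have : ∀ r, F r t = 0 := fun r => congrFun (hFt0 t h0) r
        simp [this]
  have hswap := integral_integral_swap hint
  simp_rw [hleft, hright] at hswap
  rw [integral_indicator measurableSet_Ioi, integral_indicator measurableSet_Ioi,
    integral_mul_const] at hswap
  rw [gammaMean, gammaMean, hswap, Nat.factorial_succ]
  push_cast
  rw [one_div_mul_eq_div, mul_comm ((n : ℂ) + 1)]
  simp only [one_div, mul_inv]
  ring

theorem exists_gammaMean_add {a : ℝ → ℂ} (ha : Measurable a) {C : ℝ} (hC : ∀ r, ‖a r‖ ≤ C)
    (N : ℕ) : ∃ b : ℝ → ℂ, Measurable b ∧ (∀ r, ‖b r‖ ≤ C) ∧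
      ∀ n, gammaMean b n = gammaMean a (n + N) := by
  induction N with
  | zero => exact ⟨a, ha, hC, fun n => rfl⟩
  | succ N ih =>
    obtain ⟨b, hb, hbC, h⟩ := ih
    refine ⟨shiftSymbol b, measurable_shiftSymbol hb, norm_shiftSymbol_le hbC, fun n => ?_⟩
    rw [gammaMean_shiftSymbol hb hbC, h, Nat.add_right_comm, Nat.add_assoc]

/-! ### Deconvolution of the Gaussian -/

/-- The Gaussian density which is the limit law of `√R - √n`, `R` Gamma distributed of
shape `n + 1`. -/
def gaussDensity (u : ℝ) : ℝ := Real.sqrt (2 / Real.pi) * Real.exp (-2 * u ^ 2)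

theorem integrable_gaussDensity : Integrable gaussDensity :=
  (integrable_exp_neg_mul_sq (by norm_num : (0 : ℝ) < 2)).const_mul _

-- Let `k` be the Fourier transform of a bump function equal to `1` at `0`, so that inversion at `0`
-- gives total mass `1`. Rescaling by `δ` keeps the frequency support compact, where division by the
-- nowhere vanishing Gaussian transform is harmless.
open FourierTransform SchwartzMap in
theorem exists_gaussDensity_deconvolution : ∃ k : 𝓢(ℝ, ℂ), (∫ x, k x) = 1 ∧
    ∀ δ : ℝ, 0 < δ → ∃ φ : 𝓢(ℝ, ℂ), ∀ w : ℝ,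
      ∫ u, φ (w - u) * (gaussDensity u : ℂ) = ((δ⁻¹ : ℝ) : ℂ) * k (w / δ) := by
  let B : ContDiffBump (0 : ℝ) := ⟨1, 2, by norm_num, by norm_num⟩
  have hBs : ContDiff ℝ ((⊤ : ℕ∞) : WithTop ℕ∞) (fun x => ((B x : ℝ) : ℂ)) :=
    Complex.ofRealCLM.contDiff.comp B.contDiff
  have hBc : HasCompactSupport (fun x => ((B x : ℝ) : ℂ)) :=
    B.hasCompactSupport.comp_left (g := fun x : ℝ => (x : ℂ)) (by simp)
  let ψ : 𝓢(ℝ, ℂ) := hBc.toSchwartzMap hBs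
  refine ⟨𝓕 ψ, ?_, fun δ hδ => ?_⟩
  · have h : 𝓕⁻ (𝓕 ψ) = ψ := by simp
    have h0 := congrArg (fun f : 𝓢(ℝ, ℂ) => f 0) h
    have h1 : ψ 0 = 1 := by
      change ((B 0 : ℝ) : ℂ) = 1
      rw [B.one_of_mem_closedBall (by simp [B])]
      simp
    simp only [h1] at h0
    rw [← h0, fourierInv_coe, Real.fourierInv_eq]
    simp
  -- The exponential is the reciprocal of the Fourier transform of `gaussDensity`, computed in
  -- `hgauss`.
  · let χ : ℝ → ℂ := fun ξ => ((B (δ * ξ) : ℝ) : ℂ) * Complex.exp (Real.pi ^ 2 * ξ ^ 2 / 2)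
    have hχs : ContDiff ℝ ((⊤ : ℕ∞) : WithTop ℕ∞) χ := by
      refine (hBs.comp (contDiff_const.mul contDiff_id)).mul ?_
      have : ContDiff ℝ ((⊤ : ℕ∞) : WithTop ℕ∞) (fun ξ : ℝ => (Real.pi ^ 2 * (ξ : ℂ) ^ 2 / 2 : ℂ)) := by
        have := Complex.ofRealCLM.contDiff (n := ((⊤ : ℕ∞) : WithTop ℕ∞))
        exact (contDiff_const.mul (this.pow 2)).div_const 2
      exact Complex.contDiff_exp.comp this
    have hχc : HasCompactSupport χ := by
      refine HasCompactSupport.mul_right ?_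
      exact hBc.comp_homeomorph (Homeomorph.mulLeft₀ δ hδ.ne')
    let X : 𝓢(ℝ, ℂ) := hχc.toSchwartzMap hχs
    refine ⟨𝓕 X, fun w => ?_⟩
    have hX : Integrable χ := X.integrable
    have hF : ∀ x, (𝓕 X) x = ∫ ξ : ℝ, Complex.exp (↑(-2 * Real.pi * ξ * x) * Complex.I) * χ ξ := by
      intro x
      rw [fourier_coe, Real.fourier_real_eq_integral_exp_smul]
      rfl
    have hgauss : ∀ ξ : ℝ, ∫ u, Complex.exp (↑(2 * Real.pi * ξ * u) * Complex.I) *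
        (gaussDensity u : ℂ) = Complex.exp (-(Real.pi ^ 2 * ξ ^ 2 / 2)) := by
      intro ξ
      have h := fourierIntegral_gaussian (b := 2) (by norm_num) (2 * Real.pi * ξ : ℂ)
      have h2 : ((Real.sqrt (2 / Real.pi) : ℝ) : ℂ) * ((Real.pi : ℂ) / 2) ^ (1 / 2 : ℂ) = 1 := by
        have : ((Real.pi : ℂ) / 2) ^ (1 / 2 : ℂ) = ((Real.sqrt (Real.pi / 2) : ℝ) : ℂ) := by
          rw [Real.sqrt_eq_rpow, Complex.ofReal_cpow (by positivity)]
          push_cast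
          rfl
        rw [this, ← Complex.ofReal_mul, ← Real.sqrt_mul (by positivity)]
        have hp := Real.pi_ne_zero
        rw [show 2 / Real.pi * (Real.pi / 2) = 1 by field_simp]
        simp
      calc _ = ∫ u : ℝ, ((Real.sqrt (2 / Real.pi) : ℝ) : ℂ) *
            (Complex.exp (Complex.I * (2 * Real.pi * ξ) * u) * Complex.exp (-2 * u ^ 2)) := by
            congr 1
            ext u
            rw [gaussDensity]
            push_cast
            ring_nf
        _ = _ := by
            rw [integral_const_mul, h, ← mul_assoc, h2, one_mul]
            congr 1
            ring
    have hint : Integrable (Function.uncurry fun u ξ : ℝ =>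
        Complex.exp (↑(-2 * Real.pi * ξ * (w - u)) * Complex.I) * χ ξ * (gaussDensity u : ℂ))
        (volume.prod volume) := by
      have h1 : Integrable (fun p : ℝ × ℝ => (gaussDensity p.1 : ℂ) * χ p.2)
          (volume.prod volume) := integrable_gaussDensity.ofReal.mul_prod hX
      refine h1.mono ?_ (Eventually.of_forall fun p => ?_)
      · have := hχs.continuous
        have hgc : Continuous gaussDensity := by unfold gaussDensity; fun_prop
        apply Continuous.aestronglyMeasurable
        unfold Function.uncurry
        fun_prop
      · simp only [Function.uncurry, norm_mul, Complex.norm_exp_ofReal_mul_I]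
        rw [one_mul, mul_comm]
    calc ∫ u, (𝓕 X) (w - u) * (gaussDensity u : ℂ)
        = ∫ u, ∫ ξ : ℝ, Complex.exp (↑(-2 * Real.pi * ξ * (w - u)) * Complex.I) * χ ξ *
            (gaussDensity u : ℂ) := by
          simp_rw [hF, ← integral_mul_const]
      _ = ∫ ξ : ℝ, ∫ u, Complex.exp (↑(-2 * Real.pi * ξ * (w - u)) * Complex.I) * χ ξ *
            (gaussDensity u : ℂ) := integral_integral_swap hint
      _ = ∫ ξ : ℝ, Complex.exp (↑(-2 * Real.pi * ξ * w) * Complex.I) * ((B (δ * ξ) : ℝ) : ℂ) := by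
          congr 1
          ext ξ
          have : ∀ u : ℝ, Complex.exp (↑(-2 * Real.pi * ξ * (w - u)) * Complex.I) * χ ξ *
              (gaussDensity u : ℂ) = (Complex.exp (↑(-2 * Real.pi * ξ * w) * Complex.I) * χ ξ) *
              (Complex.exp (↑(2 * Real.pi * ξ * u) * Complex.I) * (gaussDensity u : ℂ)) := by
            intro u
            rw [show (↑(-2 * Real.pi * ξ * (w - u)) * Complex.I : ℂ) =
              ↑(-2 * Real.pi * ξ * w) * Complex.I + ↑(2 * Real.pi * ξ * u) * Complex.I by
                push_cast; ring, Complex.exp_add]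
            ring
          simp_rw [this]
          rw [integral_const_mul, hgauss]
          simp only [χ]
          rw [Complex.exp_neg]
          field_simp [Complex.exp_ne_zero]
      _ = ∫ ξ : ℝ, (fun η : ℝ => Complex.exp (↑(-2 * Real.pi * η * (w / δ)) * Complex.I) *
            ((B η : ℝ) : ℂ)) (δ * ξ) := by
          congr 1
          ext ξ
          simp only
          congr 4
          field_simp
      _ = _ := by
          rw [Measure.integral_comp_mul_left (fun η : ℝ =>
            Complex.exp (↑(-2 * Real.pi * η * (w / δ)) * Complex.I) * ((B η : ℝ) : ℂ)) δ,
            abs_of_pos (inv_pos.2 hδ), fourier_coe,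
            Real.fourier_real_eq_integral_exp_smul]
          rfl

/-! ### Convergence of the square-root Gamma law to the Gaussian -/

/-- The density of the square root of a Gamma distributed variable of shape `n + 1`. -/
def sqrtGammaDensity (n : ℕ) (x : ℝ) : ℝ :=
  if 0 < x then 2 / n.factorial * (Real.exp (-x ^ 2) * x ^ (2 * n + 1)) else 0

theorem measurable_sqrtGammaDensity (n : ℕ) : Measurable (sqrtGammaDensity n) := by
  unfold sqrtGammaDensity
  refine Measurable.ite measurableSet_Ioi (by fun_prop) measurable_const

theorem gammaMean_comp_sqrt (G : ℝ → ℂ) (n : ℕ) (c : ℝ) :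
    gammaMean (fun r => G (Real.sqrt r)) n = ∫ u, G (c + u) * (sqrtGammaDensity n (c + u) : ℂ) := by
  rw [integral_add_left_eq_self (fun x => G x * (sqrtGammaDensity n x : ℂ)), gammaMean,
    ← integral_comp_rpow_Ioi_of_pos (p := 2) two_pos, ← integral_const_mul,
    ← integral_indicator measurableSet_Ioi]
  congr 1
  ext x
  by_cases hx : 0 < x
  · rw [indicator_of_mem (by simpa using hx), sqrtGammaDensity, if_pos hx]
    rw [show (2 : ℝ) - 1 = 1 by norm_num, Real.rpow_one, Real.rpow_two, Real.sqrt_sq hx.le,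
      Complex.real_smul]
    push_cast
    ring
  · rw [indicator_of_notMem (by simpa using hx), sqrtGammaDensity, if_neg hx]
    simp

/-- The factor of `sqrtGammaDensity n` controlled by Stirling's formula. -/
def stirlingFactor (n : ℕ) : ℝ := Real.sqrt 2 / Stirling.stirlingSeq n

theorem tendsto_stirlingFactor :
    Tendsto stirlingFactor atTop (𝓝 (Real.sqrt (2 / Real.pi))) := by
  rw [Real.sqrt_div (by norm_num)]
  exact tendsto_const_nhds.div Stirling.tendsto_stirlingSeq_sqrt_pi
    (Real.sqrt_ne_zero'.2 Real.pi_pos)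

theorem stirlingFactor_eq {n : ℕ} (hn : n ≠ 0) :
    stirlingFactor n = 2 / n.factorial * (Real.exp (-n) * Real.sqrt n ^ (2 * n + 1)) := by
  have hn0 : (0 : ℝ) < n := by positivity
  have hf : (n.factorial : ℝ) ≠ 0 := by positivity
  have he : Real.exp 1 ^ n = Real.exp n := by rw [← Real.exp_nat_mul, mul_one]
  have h2 : Real.sqrt 2 * Real.sqrt 2 = 2 := Real.mul_self_sqrt (by norm_num)
  rw [stirlingFactor, Stirling.stirlingSeq, Real.sqrt_mul (by norm_num), div_pow, he, pow_succ,
    pow_mul, Real.sq_sqrt hn0.le, Real.exp_neg]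
  have := Real.exp_ne_zero (n : ℝ)
  field_simp
  linear_combination h2

/-- The split serves both bound and limit: the logarithmic exponent is at most `0`, leaving `exp (-u
^ 2)` as a dominating factor, and it tends to `-u ^ 2`, giving the limit `exp (-2 * u ^ 2)`. -/
theorem sqrtGammaDensity_sqrt_add {n : ℕ} (hn : n ≠ 0) {u : ℝ} (hu : 0 < Real.sqrt n + u) :
    sqrtGammaDensity n (Real.sqrt n + u) = stirlingFactor n * ((1 + u / Real.sqrt n) *
      (Real.exp (2 * n * (Real.log (1 + u / Real.sqrt n) - u / Real.sqrt n)) *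
        Real.exp (-u ^ 2))) := by
  have hn0 : (0 : ℝ) < n := by positivity
  have hs : 0 < Real.sqrt n := Real.sqrt_pos.2 hn0
  have hss : Real.sqrt n ^ 2 = n := Real.sq_sqrt hn0.le
  set s := Real.sqrt n
  have hv : 0 < 1 + u / s := by
    have : 1 + u / s = (s + u) / s := by field_simp
    rw [this]
    positivity
  have h1 : s + u = s * (1 + u / s) := by field_simp
  have h2 : Real.exp (2 * n * Real.log (1 + u / s)) = (1 + u / s) ^ (2 * n) := by
    rw [← Real.rpow_natCast, Real.rpow_def_of_pos hv]
    push_cast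
    ring_nf
  have h3 : Real.exp (-(s + u) ^ 2) =
      Real.exp (-n) * Real.exp (-(2 * n * (u / s))) * Real.exp (-u ^ 2) := by
    rw [← Real.exp_add, ← Real.exp_add, ← hss]
    congr 1
    field_simp
    ring
  rw [sqrtGammaDensity, if_pos hu, stirlingFactor_eq hn, mul_sub, sub_eq_add_neg, Real.exp_add, h2,
    h3, h1, mul_pow, pow_succ (1 + u / s)]
  ring

theorem sqrtGammaDensity_nonneg (n : ℕ) (x : ℝ) : 0 ≤ sqrtGammaDensity n x := by
  unfold sqrtGammaDensity
  split_ifs <;> positivity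

theorem sqrtGammaDensity_sqrt_add_le {n : ℕ} (hn : n ≠ 0) (hc : stirlingFactor n ≤ 1) (u : ℝ) :
    sqrtGammaDensity n (Real.sqrt n + u) ≤ (1 + |u|) * Real.exp (-u ^ 2) := by
  by_cases hu : 0 < Real.sqrt n + u
  · have hn1 : (1 : ℝ) ≤ n := by exact_mod_cast Nat.one_le_iff_ne_zero.2 hn
    have hs : 1 ≤ Real.sqrt n := Real.one_le_sqrt.2 hn1
    have hv : 0 < 1 + u / Real.sqrt n := by
      have : 1 + u / Real.sqrt n = (Real.sqrt n + u) / Real.sqrt n := by field_simp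
      rw [this]
      positivity
    rw [sqrtGammaDensity_sqrt_add hn hu]
    have h1 : Real.exp (2 * n * (Real.log (1 + u / Real.sqrt n) - u / Real.sqrt n)) ≤ 1 := by
      rw [Real.exp_le_one_iff]
      have := Real.log_le_sub_one_of_pos hv
      exact mul_nonpos_of_nonneg_of_nonpos (by positivity) (by linarith)
    have h2 : u / Real.sqrt n ≤ |u| :=
      (div_le_div_of_nonneg_right (le_abs_self u) (by positivity)).trans
        (div_le_self (abs_nonneg u) hs)
    calc _ ≤ 1 * ((1 + u / Real.sqrt n) * (1 * Real.exp (-u ^ 2))) := by gcongr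
      _ ≤ _ := by
        rw [one_mul, one_mul]
        gcongr
  · rw [sqrtGammaDensity, if_neg hu]
    positivity

theorem integrable_one_add_abs_mul_exp_neg_sq :
    Integrable fun u : ℝ => (1 + |u|) * Real.exp (-u ^ 2) := by
  have h1 : Integrable fun u : ℝ => Real.exp (-1 * u ^ 2) := integrable_exp_neg_mul_sq one_pos
  have h2 : Integrable fun u : ℝ => u * Real.exp (-1 * u ^ 2) :=
    integrable_mul_exp_neg_mul_sq one_pos
  refine (h1.add h2.norm).congr (Eventually.of_forall fun u => ?_)
  simp only [Pi.add_apply, norm_mul, Real.norm_eq_abs, Real.abs_exp]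
  ring_nf

theorem tendsto_mul_log_one_add_div_sqrt_sub (u : ℝ) :
    Tendsto (fun n : ℕ => 2 * (n : ℝ) * (Real.log (1 + u / Real.sqrt n) - u / Real.sqrt n))
      atTop (𝓝 (-u ^ 2)) := by
  have hs : Tendsto (fun n : ℕ => Real.sqrt n) atTop atTop :=
    Real.tendsto_sqrt_atTop.comp tendsto_natCast_atTop_atTop
  have hv : Tendsto (fun n : ℕ => u / Real.sqrt n) atTop (𝓝 0) := tendsto_const_nhds.div_atTop hs
  have hb : Tendsto (fun n : ℕ => 2 * u ^ 2 * (|u / Real.sqrt n| / (1 - |u / Real.sqrt n|)))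
      atTop (𝓝 0) := by
    have ha : Tendsto (fun n : ℕ => |u / Real.sqrt n|) atTop (𝓝 0) := by simpa using hv.abs
    have := (ha.div (tendsto_const_nhds (x := (1 : ℝ)).sub ha) (by norm_num)).const_mul (2 * u ^ 2)
    simpa using this
  rw [tendsto_iff_norm_sub_tendsto_zero]
  refine squeeze_zero' (Eventually.of_forall fun _ => norm_nonneg _) ?_ hb
  have hlt : ∀ᶠ n : ℕ in atTop, |u / Real.sqrt n| < 1 := by
    have ha : Tendsto (fun n : ℕ => |u / Real.sqrt n|) atTop (𝓝 0) := by simpa using hv.abs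
    exact ha.eventually_lt_const one_pos
  filter_upwards [hlt, eventually_ne_atTop 0] with n hn hn0
  have hnp : (0 : ℝ) < n := by positivity
  have hss : Real.sqrt n ^ 2 = n := Real.sq_sqrt hnp.le
  have hsp : 0 < Real.sqrt n := Real.sqrt_pos.2 hnp
  set v := u / Real.sqrt n
  have hu : u ^ 2 = n * v ^ 2 := by
    rw [← hss]
    simp only [v]
    field_simp
  -- Second-order Taylor bound; since `n * v ^ 2 = u ^ 2`, the cubic remainder times `2 * n` is `2 *
  -- u ^ 2 * (|v| / (1 - |v|))`.
  have h := Real.abs_log_sub_add_sum_range_le (x := -v) (by rwa [abs_neg]) 2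
  simp only [Finset.sum_range_succ, Finset.sum_range_zero, abs_neg, sub_neg_eq_add] at h
  have h1 : 2 * (n : ℝ) * (Real.log (1 + v) - v) - -u ^ 2 =
      2 * n * (Real.log (1 + v) - v + v ^ 2 / 2) := by
    rw [hu]
    ring
  rw [h1, Real.norm_eq_abs, abs_mul, abs_of_pos (by positivity : (0 : ℝ) < 2 * n), hu,
    ← sq_abs v]
  calc 2 * (n : ℝ) * |Real.log (1 + v) - v + |v| ^ 2 / 2|
      ≤ 2 * n * (|v| ^ (2 + 1) / (1 - |v|)) := by
        gcongr
        refine le_of_eq_of_le ?_ h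
        rw [sq_abs]
        congr 1
        norm_num
        ring
    _ = _ := by ring

theorem tendsto_sqrtGammaDensity (u : ℝ) :
    Tendsto (fun n : ℕ => sqrtGammaDensity n (Real.sqrt n + u)) atTop (𝓝 (gaussDensity u)) := by
  have hs : Tendsto (fun n : ℕ => Real.sqrt n) atTop atTop :=
    Real.tendsto_sqrt_atTop.comp tendsto_natCast_atTop_atTop
  have hv : Tendsto (fun n : ℕ => u / Real.sqrt n) atTop (𝓝 0) := tendsto_const_nhds.div_atTop hs
  have h := tendsto_stirlingFactor.mul (((tendsto_const_nhds (x := (1 : ℝ))).add hv).mul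
    (((Real.continuous_exp.tendsto _).comp (tendsto_mul_log_one_add_div_sqrt_sub u)).mul_const
      (Real.exp (-u ^ 2))))
  have hlim : Real.sqrt (2 / Real.pi) * ((1 + 0) * (Real.exp (-u ^ 2) * Real.exp (-u ^ 2))) =
      gaussDensity u := by
    rw [gaussDensity, ← Real.exp_add]
    ring_nf
  rw [hlim] at h
  refine h.congr' ?_
  filter_upwards [hs.eventually_gt_atTop (-u), eventually_ne_atTop 0] with n hn hn0
  exact (sqrtGammaDensity_sqrt_add hn0 (by linarith)).symm

theorem stirlingFactor_eventually_le_one : ∀ᶠ n in atTop, stirlingFactor n ≤ 1 := by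
  refine tendsto_stirlingFactor.eventually_le_const ?_
  rw [Real.sqrt_lt' one_pos, one_pow, div_lt_one Real.pi_pos]
  linarith [Real.pi_gt_three]

theorem tendsto_integral_norm_sqrtGammaDensity_sub :
    Tendsto (fun n : ℕ => ∫ u, ‖sqrtGammaDensity n (Real.sqrt n + u) - gaussDensity u‖)
      atTop (𝓝 0) := by
  have h := tendsto_integral_filter_of_dominated_convergence
    (F := fun (n : ℕ) u => ‖sqrtGammaDensity n (Real.sqrt n + u) - gaussDensity u‖)
    (f := fun _ => 0) (μ := volume) (l := atTop)
    (fun u => (1 + |u|) * Real.exp (-u ^ 2) + ‖gaussDensity u‖) ?_ ?_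
    (integrable_one_add_abs_mul_exp_neg_sq.add integrable_gaussDensity.norm) ?_
  · simpa using h
  · refine Eventually.of_forall fun n => ?_
    exact ((((measurable_sqrtGammaDensity n).comp (measurable_const_add _)).aestronglyMeasurable).sub
      integrable_gaussDensity.aestronglyMeasurable).norm
  · filter_upwards [stirlingFactor_eventually_le_one, eventually_ne_atTop 0] with n hc hn
    refine Eventually.of_forall fun u => ?_
    rw [norm_norm]
    refine (norm_sub_le _ _).trans (add_le_add_left ?_ _)
    rw [Real.norm_of_nonneg (sqrtGammaDensity_nonneg _ _)]
    exact sqrtGammaDensity_sqrt_add_le hn hc u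
  · refine Eventually.of_forall fun u => ?_
    simpa using (tendsto_sqrtGammaDensity u).sub_const (gaussDensity u) |>.norm

theorem tendsto_gammaMean_comp_sqrt_sub {G : ℝ → ℂ} (hG : Measurable G) {C : ℝ}
    (hC : ∀ x, ‖G x‖ ≤ C) :
    Tendsto (fun n : ℕ => gammaMean (fun r => G (Real.sqrt r)) n -
      ∫ u, G (Real.sqrt n + u) * (gaussDensity u : ℂ)) atTop (𝓝 0) := by
  have hlim := tendsto_integral_norm_sqrtGammaDensity_sub.const_mul C
  rw [mul_zero] at hlim
  refine squeeze_zero_norm' ?_ hlim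
  filter_upwards [stirlingFactor_eventually_le_one, eventually_ne_atTop 0] with n hc hn
  have hp : Integrable fun u => sqrtGammaDensity n (Real.sqrt n + u) := by
    refine integrable_one_add_abs_mul_exp_neg_sq.mono'
      ((measurable_sqrtGammaDensity n).comp (measurable_const_add _)).aestronglyMeasurable
      (Eventually.of_forall fun u => ?_)
    rw [Real.norm_of_nonneg (sqrtGammaDensity_nonneg _ _)]
    exact sqrtGammaDensity_sqrt_add_le hn hc u
  have hGm : AEStronglyMeasurable (fun u => G (Real.sqrt n + u)) volume :=
    (hG.comp (measurable_const_add _)).aestronglyMeasurable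
  have hGb : ∀ᵐ u ∂(volume : Measure ℝ), ‖G (Real.sqrt n + u)‖ ≤ C :=
    Eventually.of_forall fun u => hC _
  have hi₁ : Integrable fun u =>
      G (Real.sqrt n + u) * (sqrtGammaDensity n (Real.sqrt n + u) : ℂ) :=
    hp.ofReal.bdd_mul hGm hGb
  have hi₂ : Integrable fun u => G (Real.sqrt n + u) * (gaussDensity u : ℂ) :=
    integrable_gaussDensity.ofReal.bdd_mul hGm hGb
  rw [gammaMean_comp_sqrt G n (Real.sqrt n), ← integral_sub hi₁ hi₂, ← integral_const_mul]
  refine norm_integral_le_of_norm_le ((hp.sub integrable_gaussDensity).norm.const_mul C) ?_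
  refine Eventually.of_forall fun u => ?_
  rw [← mul_sub, ← Complex.ofReal_sub, norm_mul, Complex.norm_real]
  exact mul_le_mul_of_nonneg_right (hC _) (norm_nonneg _)

/-! ### Interpolation, smoothing and approximation for large indices -/

-- The witness is `G x = ∫ f (x + y) φ y`; Fubini moves the Gaussian from `G` onto `φ`, where `hφ`
-- turns it into the rescaled `k`.
open SchwartzMap in
theorem exists_integral_gaussDensity_eq {f : ℝ → ℂ} (hf : Measurable f) {A : ℝ}
    (hA : ∀ x, ‖f x‖ ≤ A) {k φ : 𝓢(ℝ, ℂ)} {δ : ℝ} (hδ : 0 < δ)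
    (hφ : ∀ w : ℝ, ∫ u, φ (w - u) * (gaussDensity u : ℂ) = ((δ⁻¹ : ℝ) : ℂ) * k (w / δ)) :
    ∃ G : ℝ → ℂ, Measurable G ∧ (∃ C : ℝ, ∀ x, ‖G x‖ ≤ C) ∧
      ∀ s, ∫ u, G (s + u) * (gaussDensity u : ℂ) = ∫ v, f (s + δ * v) * k v := by
  refine ⟨fun x => ∫ y, f (x + y) * φ y, ?_, ⟨A * ∫ y, ‖φ y‖, fun x => ?_⟩, fun s => ?_⟩
  · have h : StronglyMeasurable (Function.uncurry fun x y : ℝ => f (x + y) * φ y) := by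
      apply Measurable.stronglyMeasurable
      have := φ.continuous.measurable
      unfold Function.uncurry
      fun_prop
    exact (h.integral_prod_right (ν := volume)).measurable
  · rw [← integral_const_mul]
    refine norm_integral_le_of_norm_le (φ.integrable.norm.const_mul A) ?_
    refine Eventually.of_forall fun y => ?_
    rw [norm_mul]
    exact mul_le_mul_of_nonneg_right (hA _) (norm_nonneg _)
  · have hint : Integrable (Function.uncurry fun u w : ℝ =>
        f (s + w) * (φ (w - u) * (gaussDensity u : ℂ))) (volume.prod volume) := by
      have h0 : Integrable (fun u => (gaussDensity u : ℂ)) := integrable_gaussDensity.ofReal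
      have h1 := (h0.convolution_integrand (ContinuousLinearMap.mul ℂ ℂ)
        (φ.integrable (μ := volume))).swap
      have h2 : Integrable (fun p : ℝ × ℝ => φ (p.2 - p.1) * (gaussDensity p.1 : ℂ))
          (volume.prod volume) := by
        refine h1.congr (Eventually.of_forall fun p => ?_)
        simp [mul_comm]
      exact h2.bdd_mul (c := A)
        (hf.comp ((measurable_const_add s).comp measurable_snd)).aestronglyMeasurable
        (Eventually.of_forall fun p => hA _)
    calc ∫ u, (∫ y, f (s + u + y) * φ y) * (gaussDensity u : ℂ)
        = ∫ u, ∫ w, f (s + w) * (φ (w - u) * (gaussDensity u : ℂ)) := by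
          congr 1
          ext u
          rw [← integral_mul_const, ← integral_sub_right_eq_self _ u]
          congr 1
          ext w
          rw [show s + u + (w - u) = s + w by ring, mul_assoc]
      _ = ∫ w, ∫ u, f (s + w) * (φ (w - u) * (gaussDensity u : ℂ)) := integral_integral_swap hint
      _ = ∫ w, ((δ⁻¹ : ℝ) : ℂ) * ((fun v => f (s + δ * v) * k v) (w / δ)) := by
          congr 1
          ext w
          rw [integral_const_mul, hφ]
          simp only
          rw [mul_div_cancel₀ _ hδ.ne']
          ring
      _ = _ := by
          rw [integral_const_mul, Measure.integral_comp_div (fun v => f (s + δ * v) * k v) δ,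
            abs_of_pos hδ, Complex.real_smul,
            ← mul_assoc, ← Complex.ofReal_mul, inv_mul_cancel₀ hδ.ne', Complex.ofReal_one, one_mul]

/-- A step function on the line interpolating the values `σ n` at the points `√n`. -/
def sqrtInterp (σ : ℕ → ℂ) (x : ℝ) : ℂ := σ ⌊(max x 0) ^ 2⌋₊

theorem measurable_sqrtInterp (σ : ℕ → ℂ) : Measurable (sqrtInterp σ) :=
  (measurable_of_countable σ).comp (Nat.measurable_floor.comp (by fun_prop))

theorem sqrtDist_floor_sq_le {η x : ℝ} {n : ℕ} (hη : 0 < η) (hn : 2 * η + 1 / η ≤ Real.sqrt n)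
    (hx : |x - Real.sqrt n| ≤ η) : sqrtDist ⌊(max x 0) ^ 2⌋₊ n ≤ 2 * η := by
  obtain ⟨h1, h2⟩ := abs_le.1 hx
  have hx1 : η + 1 / η ≤ x := by linarith
  have hinv : 0 < 1 / η := by positivity
  have hx0 : 0 ≤ x := by linarith
  rw [max_eq_left hx0]
  have hm1 : Real.sqrt ⌊x ^ 2⌋₊ ≤ x := Real.sqrt_le_iff.2 ⟨hx0, Nat.floor_le (sq_nonneg x)⟩
  have hm2 : x - η ≤ Real.sqrt ⌊x ^ 2⌋₊ := by
    apply Real.le_sqrt_of_sq_le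
    -- Since `x ≥ η + 1 / η`, `x² - (x - η)² = 2ηx - η² ≥ η² + 2`, which absorbs the loss of at most
    -- `1` from the floor.
    have h3 := Nat.lt_floor_add_one (x ^ 2)
    have h4 : (η + 1 / η) * η ≤ x * η := by gcongr
    have h5 : (η + 1 / η) * η = η ^ 2 + 1 := by field_simp
    nlinarith [sq_nonneg η]
  rw [sqrtDist, abs_le]
  constructor <;> linarith

theorem exists_forall_sqrtDist_le {σ : EllInfty} (hσ : σ ∈ RO) {ε : ℝ} (hε : 0 < ε) :
    ∃ η > 0, ∀ j k, sqrtDist j k ≤ 2 * η → ‖σ j - σ k‖ ≤ ε := by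
  have h : Tendsto (modulus fun n => σ n) (𝓝[>] (0 : ℝ)) (𝓝 0) := hσ
  have h1 : ∀ᶠ δ in 𝓝[>] (0 : ℝ), modulus (fun n => σ n) δ ≤ ENNReal.ofReal ε :=
    h.eventually_le_const (ENNReal.ofReal_pos.2 hε)
  obtain ⟨δ, hδ, hδ0⟩ := (h1.and self_mem_nhdsWithin).exists
  refine ⟨δ / 2, half_pos hδ0, fun j k hjk => ?_⟩
  rw [mul_div_cancel₀ _ two_ne_zero] at hjk
  rw [← ENNReal.ofReal_le_ofReal_iff hε.le]
  refine le_trans ?_ hδ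
  exact le_iSup_of_le j (le_iSup_of_le k (le_iSup_of_le hjk le_rfl))

theorem norm_sqrtInterp_le (σ : EllInfty) (x : ℝ) : ‖sqrtInterp (fun n => σ n) x‖ ≤ ‖σ‖ :=
  lp.norm_apply_le_norm ENNReal.top_ne_zero σ _

/-- Beyond distance `η` the trivial bound `2‖σ‖` is at most `2‖σ‖ |w| / η`. Linear growth in `w`
leaves only a first moment of the kernel to control, and that moment scales with `δ`. -/
theorem norm_sqrtInterp_sub_le {σ : EllInfty} {ε η : ℝ} (hη : 0 < η) (hε : 0 ≤ ε)
    (h : ∀ j k, sqrtDist j k ≤ 2 * η → ‖σ j - σ k‖ ≤ ε) {n : ℕ}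
    (hn : 2 * η + 1 / η ≤ Real.sqrt n) (w : ℝ) :
    ‖sqrtInterp (fun n => σ n) (Real.sqrt n + w) - σ n‖ ≤ ε + 2 * ‖σ‖ / η * |w| := by
  by_cases hw : |w| ≤ η
  · refine (h _ _ (sqrtDist_floor_sq_le hη hn (by rwa [add_sub_cancel_left]))).trans ?_
    have : 0 ≤ 2 * ‖σ‖ / η * |w| := by positivity
    linarith
  · have h1 : ‖sqrtInterp (fun n => σ n) (Real.sqrt n + w) - σ n‖ ≤ ‖σ‖ + ‖σ‖ :=
      (norm_sub_le _ _).trans (add_le_add (norm_sqrtInterp_le σ _)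
        (lp.norm_apply_le_norm ENNReal.top_ne_zero σ n))
    have h2 : 2 * ‖σ‖ / η * η ≤ 2 * ‖σ‖ / η * |w| := by
      have := (not_le.1 hw).le
      gcongr
    rw [div_mul_cancel₀ _ hη.ne'] at h2
    linarith

theorem exists_gammaMean_approx {σ : EllInfty} (hσ : σ ∈ RO) {ε : ℝ} (hε : 0 < ε) :
    ∃ a : ℝ → ℂ, Measurable a ∧ (∃ C : ℝ, ∀ r, ‖a r‖ ≤ C) ∧
      ∀ᶠ n in atTop, ‖σ n - gammaMean a n‖ ≤ ε := by
  obtain ⟨k, hk1, hk⟩ := exists_gaussDensity_deconvolution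
  have hkA : Integrable fun v => ‖k v‖ := k.integrable.norm
  have hkB : Integrable fun v => |v| * ‖k v‖ := by simpa using k.integrable_pow_mul volume 1
  set A := ∫ v, ‖k v‖
  set B := ∫ v, |v| * ‖k v‖
  have hA : 0 ≤ A := integral_nonneg fun _ => norm_nonneg _
  have hB : 0 ≤ B := integral_nonneg fun _ => mul_nonneg (abs_nonneg _) (norm_nonneg _)
  -- One third of `ε` each goes to the oscillation of `σ`, the tail of the kernel and the Gaussian
  -- limit; `A + 1` and, below, `D + 1` avoid division by zero.
  set ε' := ε / 3 / (A + 1)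
  have hε' : 0 < ε' := by positivity
  obtain ⟨η, hη, hση⟩ := exists_forall_sqrtDist_le hσ hε'
  set D := 2 * ‖σ‖ / η * B
  have hD : 0 ≤ D := by positivity
  set δ := ε / 3 / (D + 1)
  have hδ : 0 < δ := by positivity
  obtain ⟨φ, hφ⟩ := hk δ hδ
  set f := sqrtInterp fun n => σ n
  obtain ⟨G, hG, ⟨C, hC⟩, hGs⟩ := exists_integral_gaussDensity_eq
    (measurable_sqrtInterp fun n => σ n) (norm_sqrtInterp_le σ) hδ hφ
  refine ⟨fun r => G (Real.sqrt r), hG.comp Real.continuous_sqrt.measurable,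
    ⟨C, fun r => hC _⟩, ?_⟩
  have hlim := (tendsto_gammaMean_comp_sqrt_sub hG hC).norm
  rw [norm_zero] at hlim
  have hs : Tendsto (fun n : ℕ => Real.sqrt n) atTop atTop :=
    Real.tendsto_sqrt_atTop.comp tendsto_natCast_atTop_atTop
  filter_upwards [hlim.eventually_le_const (by positivity : (0 : ℝ) < ε / 3),
    hs.eventually_ge_atTop (2 * η + 1 / η)] with n hn1 hn2
  rw [hGs] at hn1
  have hfk : Integrable fun v => f (Real.sqrt n + δ * v) * k v :=
    k.integrable.bdd_mul (c := ‖σ‖) ((measurable_sqrtInterp fun n => σ n).comp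
      (by fun_prop)).aestronglyMeasurable (Eventually.of_forall fun v => norm_sqrtInterp_le σ _)
  have hn3 : ‖(∫ v, f (Real.sqrt n + δ * v) * k v) - σ n‖ ≤ ε' * A + δ * D := by
    have h1 : (∫ v, f (Real.sqrt n + δ * v) * k v) - σ n =
        ∫ v, (f (Real.sqrt n + δ * v) - σ n) * k v := by
      simp_rw [sub_mul]
      rw [integral_sub hfk (k.integrable.const_mul _), integral_const_mul, hk1, mul_one]
    have h2 : ε' * A + δ * D =
        ∫ v, (ε' * ‖k v‖ + δ * (2 * ‖σ‖ / η) * (|v| * ‖k v‖)) := by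
      rw [integral_add (hkA.const_mul _) (hkB.const_mul _), integral_const_mul,
        integral_const_mul]
      ring
    rw [h1, h2]
    refine norm_integral_le_of_norm_le ((hkA.const_mul _).add (hkB.const_mul _))
      (Eventually.of_forall fun v => ?_)
    rw [norm_mul]
    have h3 := norm_sqrtInterp_sub_le hη hε'.le hση hn2 (δ * v)
    rw [abs_mul, abs_of_pos hδ] at h3
    refine (mul_le_mul_of_nonneg_right h3 (norm_nonneg _)).trans_eq ?_
    ring
  have h4 : ε' * A ≤ ε / 3 := by
    have : ε' * (A + 1) = ε / 3 := div_mul_cancel₀ _ (by positivity)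
    linarith
  have h5 : δ * D ≤ ε / 3 := by
    have : δ * (D + 1) = ε / 3 := div_mul_cancel₀ _ (by positivity)
    linarith
  rw [norm_sub_rev]
  have h6 := norm_add_le_of_le hn1 hn3
  rw [sub_add_sub_cancel] at h6
  linarith

theorem leftShift_pow_apply (N : ℕ) (σ : EllInfty) (j : ℕ) :
    (leftShift ^ N) σ j = σ (j + N) := by
  induction N generalizing j with
  | zero => rfl
  | succ N ih =>
    rw [pow_succ', mul_apply_eq_comp, leftShift_apply, ih, Nat.add_right_comm,
      Nat.add_assoc]

end

end RadialFock

theorem mainTheorem5 (σ : RadialFock.EllInfty) (hσ : σ ∈ RadialFock.RO) (ε : ℝ) (hε : 0 < ε) :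
    ∃ N : ℕ, 1 ≤ N ∧ ∃ g : RadialFock.LInftyHalfLine,
      ‖(RadialFock.leftShift ^ N) σ - RadialFock.gammaSeq g‖ < ε := by
  obtain ⟨a, ha, ⟨C, hC⟩, h⟩ := RadialFock.exists_gammaMean_approx hσ (half_pos hε)
  obtain ⟨N, hN⟩ := eventually_atTop.1 h
  -- `N + 1` rather than `N` because the shift must be at least `1`; the `ε / 2` bound makes the
  -- supremum strictly less than `ε`.
  obtain ⟨b, hb, hbC, hab⟩ := RadialFock.exists_gammaMean_add ha hC (N + 1)
  obtain ⟨g, hg⟩ := RadialFock.exists_gammaCoeff_eq hb hbC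
  refine ⟨N + 1, Nat.le_add_left 1 N, g, lt_of_le_of_lt ?_ (half_lt_self hε)⟩
  refine lp.norm_le_of_forall_le (half_pos hε).le fun j => ?_
  have h1 : ((RadialFock.leftShift ^ (N + 1)) σ - RadialFock.gammaSeq g) j =
      σ (j + (N + 1)) - RadialFock.gammaMean a (j + (N + 1)) := by
    rw [← hab, ← hg, ← RadialFock.leftShift_pow_apply]
    rfl
  rw [h1]
  exact hN _ (by omega)
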